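/- Let $N\ge 0$ and equip $\mathbb{R}^{N\times N}$ with the Frobenius inner product $\langle A,B\rangle=\mathrm{tr}(A^{T}B)$ and norm $\|\cdot\|_F$. Let $\mathcal{S}^N$ be the space of symmetric matrices, and let $E$ be a linear subspace with $\mathcal{S}^N\subseteq E\subseteq\mathbb{R}^{N\times N}$, the ambient Euclidean space (for instance $E=\mathcal{S}^N$, the case of undirected graphs, or $E=\mathbb{R}^{N\times N}$). Let $\Lambda_o$ be a diagonal $N\times N$ matrix with non-increasing diagonal and $$\mathcal{M}=\{M\in\mathcal{S}^N : M=V\Lambda_oV^{T}\ \text{for some orthogonal } V\}.$$ Let $\mathcal{S}\subseteq E$ be a convex set such that (A.1) $\mathcal{S}$ is closed, and (A.2) every $X\in\mathbb{R}^{N\times N}$ has exactly one projection onto $\mathcal{S}$. For a set $C\subseteq E$, let $P_C(X)$ be the set of all best approximants of $X$ in $C$ in the Frobenius norm, and let the normal cone $N_C(X)$ be the set of all limits $\lim_i t_i(Z_i-Y_i)$ with $t_i\ge 0$, $Z_i\in E$, $Z_i\to X$, $Y_i\in P_C(Z_i)$. Suppose that $\mathcal{M}$ and $\mathcal{S}$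 have a strongly regular intersection at $\bar S\in\mathcal{M}\cap\mathcal{S}$, i.e. the constant $$\bar c=\max\{\langle u,v\rangle : u\in N_{\mathcal{M}}(\bar S)\cap B,\ v\in -N_{\mathcal{S}}(\bar S)\cap B\}$$ is strictly less than one, where $B$ is the closed unit ball of the Frobenius norm. Then for every $r\in(\bar c,1)$ there is $\delta>0$ such that every sequence with $S_0\in\mathcal{M}$, $\|S_0-\bar S\|_F<\delta$ and $$S_{k+1/2}\in P_{\mathcal{S}}(S_k),\qquad S_{k+1}\in P_{\mathcal{M}}(S_{k+1/2})\qquad(k=0,1,2,\dots)$$ converges to a point $L\in\mathcal{M}\cap\mathcal{S}$ with $R$-linear rate $r$: the iterates $S_k$ and the half-iterates $S_{k+1/2}$ both converge to $L$, and there is a constant $K$ with $\|S_k-L\|_F\le K r^k$ and $\|S_{k+1/2}-L\|_F\le Kr^k$ for all $k$. -/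

import Mathlib

open Filter Topology

noncomputable section

/-- The Frobenius inner product `⟨A, B⟩ = tr (Aᵀ B)` on real `N × N` matrices. -/
def frobInner {N : ℕ} (A B : Matrix (Fin N) (Fin N) ℝ) : ℝ :=
  (A.transpose * B).trace

/-- The Frobenius (Euclidean) norm of a real `N × N` matrix. -/
def frobNorm {N : ℕ} (A : Matrix (Fin N) (Fin N) ℝ) : ℝ :=
  Real.sqrt (frobInner A A)

/-- The linear space of real symmetric `N × N` matrices. -/
def symmMatrices (N : ℕ) : Submodule ℝ (Matrix (Fin N) (Fin N) ℝ) where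
  carrier := {A | A.IsSymm}
  add_mem' := fun hA hB => Matrix.IsSymm.add hA hB
  zero_mem' := Matrix.isSymm_zero
  smul_mem' := fun c _ hA => Matrix.IsSymm.smul hA c

/-- The set `{M symmetric | M = V Λ Vᵀ for some orthogonal V}`, where `Λ` is the diagonal matrix
with diagonal `lam`: the symmetric matrices with prescribed spectrum `lam`. -/
def isospectralSet {N : ℕ} (lam : Fin N → ℝ) : Set (Matrix (Fin N) (Fin N) ℝ) :=
  {M | M ∈ symmMatrices N ∧ ∃ V ∈ Matrix.orthogonalGroup (Fin N) ℝ,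
    M = V * Matrix.diagonal lam * V.transpose}

/-- The (set-valued) metric projection onto `C`: all best approximants of `X` in `C` in the
Frobenius norm. -/
def projSet {N : ℕ} (C : Set (Matrix (Fin N) (Fin N) ℝ)) (X : Matrix (Fin N) (Fin N) ℝ) :
    Set (Matrix (Fin N) (Fin N) ℝ) :=
  {Y | Y ∈ C ∧ ∀ Z ∈ C, frobNorm (X - Y) ≤ frobNorm (X - Z)}

/-- The (limiting) normal cone at `X` of a set `C` contained in the Euclidean space `E`: the limits
of sequences `tᵢ (Zᵢ - Yᵢ)` with `tᵢ ≥ 0`, `Zᵢ ∈ E`, `Zᵢ → X` and `Yᵢ` a projection of `Zᵢ`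
onto `C`. -/
def normalCone {N : ℕ} (E : Submodule ℝ (Matrix (Fin N) (Fin N) ℝ))
    (C : Set (Matrix (Fin N) (Fin N) ℝ)) (X : Matrix (Fin N) (Fin N) ℝ) :
    Set (Matrix (Fin N) (Fin N) ℝ) :=
  {W | ∃ (t : ℕ → ℝ) (Z Y : ℕ → Matrix (Fin N) (Fin N) ℝ),
    (∀ i, 0 ≤ t i) ∧ (∀ i, Z i ∈ E) ∧ (∀ i, Y i ∈ projSet C (Z i)) ∧
    Tendsto Z atTop (𝓝 X) ∧ Tendsto (fun i => t i • (Z i - Y i)) atTop (𝓝 W)}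

/-- The values `⟨u, v⟩` with `u ∈ N_M(X) ∩ B` and `v ∈ -N_S(X) ∩ B`, `B` the closed unit ball. -/
def regularityValues {N : ℕ} (E : Submodule ℝ (Matrix (Fin N) (Fin N) ℝ))
    (M S : Set (Matrix (Fin N) (Fin N) ℝ)) (X : Matrix (Fin N) (Fin N) ℝ) : Set ℝ :=
  {c | ∃ u v : Matrix (Fin N) (Fin N) ℝ, u ∈ normalCone E M X ∧ frobNorm u ≤ 1 ∧
    -v ∈ normalCone E S X ∧ frobNorm v ≤ 1 ∧ c = frobInner u v}

/-- The constant `c̄ = max {⟨u, v⟩ | u ∈ N_M(X) ∩ B, v ∈ -N_S(X) ∩ B}`. -/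
def regularityConst {N : ℕ} (E : Submodule ℝ (Matrix (Fin N) (Fin N) ℝ))
    (M S : Set (Matrix (Fin N) (Fin N) ℝ)) (X : Matrix (Fin N) (Fin N) ℝ) : ℝ :=
  sSup (regularityValues E M S X)

/-- The matrices `x k` (iterates) and `y k` (half-iterates, `y k = S_{k+1/2}`) are generated by
alternating projections: `x 0 ∈ M`, `y k` is a projection of `x k` onto `S`, and `x (k+1)` is a
projection of `y k` onto `M`. -/
def IsAlternatingProjection {N : ℕ} (M S : Set (Matrix (Fin N) (Fin N) ℝ))
    (x y : ℕ → Matrix (Fin N) (Fin N) ℝ) : Prop :=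
  x 0 ∈ M ∧ ∀ k, y k ∈ projSet S (x k) ∧ x (k + 1) ∈ projSet M (y k)

theorem frobInner_eq_sum {N : ℕ} (A B : Matrix (Fin N) (Fin N) ℝ) :
    frobInner A B = ∑ p : Fin N × Fin N, A p.2 p.1 * B p.2 p.1 := by
  simp [frobInner, Matrix.trace, Matrix.mul_apply, Fintype.sum_prod_type]

theorem zero_mem_normalCone {N : ℕ} {E : Submodule ℝ (Matrix (Fin N) (Fin N) ℝ)}
    {C : Set (Matrix (Fin N) (Fin N) ℝ)} {X : Matrix (Fin N) (Fin N) ℝ} (hE : X ∈ E) (hX : X ∈ C) :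
    (0 : Matrix (Fin N) (Fin N) ℝ) ∈ normalCone E C X := by
  refine ⟨fun _ => 0, fun _ => X, fun _ => X, fun _ => le_rfl, fun _ => hE, fun _ => ⟨hX, ?_⟩,
    tendsto_const_nhds, by simp⟩
  intro Z _
  simp [frobNorm, frobInner, Real.sqrt_nonneg]

/-- The supremum that defines the constant is over a nonempty set. -/
theorem regularityValues_nonempty {N : ℕ} {E : Submodule ℝ (Matrix (Fin N) (Fin N) ℝ)}
    {M S : Set (Matrix (Fin N) (Fin N) ℝ)} {X : Matrix (Fin N) (Fin N) ℝ}
    (hE : X ∈ E) (hM : X ∈ M) (hS : X ∈ S) : (regularityValues E M S X).Nonempty := by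
  refine ⟨0, 0, 0, zero_mem_normalCone hE hM, ?_, ?_, ?_, ?_⟩
  · simp [frobNorm, frobInner]
  · simpa using zero_mem_normalCone hE hS
  · simp [frobNorm, frobInner]
  · simp [frobInner]

/-- The supremum that defines the constant is over a set bounded above by one. -/
theorem regularityValues_bddAbove {N : ℕ} (E : Submodule ℝ (Matrix (Fin N) (Fin N) ℝ))
    (M S : Set (Matrix (Fin N) (Fin N) ℝ)) (X : Matrix (Fin N) (Fin N) ℝ) :
    BddAbove (regularityValues E M S X) := by
  refine ⟨1, ?_⟩
  rintro c ⟨u, v, -, hu, -, hv, rfl⟩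
  have h := Real.sum_mul_le_sqrt_mul_sqrt Finset.univ
    (fun p : Fin N × Fin N => u p.2 p.1) (fun p => v p.2 p.1)
  have e : ∀ A : Matrix (Fin N) (Fin N) ℝ,
      frobNorm A = Real.sqrt (∑ p : Fin N × Fin N, A p.2 p.1 ^ 2) := by
    intro A
    simp only [frobNorm, frobInner_eq_sum, sq]
  rw [← e, ← e, ← frobInner_eq_sum] at h
  exact h.trans (mul_le_one₀ hu (Real.sqrt_nonneg _) hv)

end

/-! Take successive points `y ∈ S`, `x ∈ P_M(y)`, `z ∈ P_S(x)`. The directions of `y - x` and `x -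
z` are proximal normals to `M` and `S`. By compactness of the unit ball, if such triples came
arbitrarily close to `Sbar` with the cosine at `x` above `r`, limits of these directions would give
a regularity value at least `r > c̄`. So near `Sbar` the cosine is at most `r`. Convexity of `S`
makes the angle at `z` non-acute, hence `‖z - x‖² ≤ ⟪y - x, z - x⟫ ≤ r ‖y - x‖ ‖z - x‖`: projecting
onto `S` contracts the gap by `r`, while projecting onto `M` does not increase it. The steps are
then summable, so a sequence that starts close enough to `Sbar` never leaves the good ball and is
Cauchy; closedness puts its limit in both sets. -/

open scoped RealInnerProductSpace

section InnerProductSpace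

variable {V : Type*} [NormedAddCommGroup V] [InnerProductSpace ℝ V]

/-- If the angle at `x` between `y` and `z` has cosine at most `r`, and the angle at `z` between
`x` and `y` is not acute, then `z` is closer to `x` than `y` by the factor `r`. -/
theorem norm_sub_le_mul_of_inner_le {x y z : V} {r : ℝ} (hz : ⟪x - z, y - z⟫ ≤ 0)
    (hx : ⟪y - x, z - x⟫ ≤ r * ‖y - x‖ * ‖z - x‖) (hr : 0 ≤ r) :
    ‖z - x‖ ≤ r * ‖y - x‖ := by
  have h : ‖z - x‖ * ‖z - x‖ ≤ r * ‖y - x‖ * ‖z - x‖ := by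
    have e : ‖z - x‖ * ‖z - x‖ = ⟪x - z, y - z⟫ + ⟪y - x, z - x⟫ := by
      rw [← real_inner_self_eq_norm_mul_norm, ← neg_sub z x, inner_neg_left,
        real_inner_comm (y - z) (z - x), ← sub_eq_neg_add, ← inner_sub_left]
      congr 1
      abel
    linarith
  rcases (norm_nonneg (z - x)).eq_or_lt with h0 | h0
  · rw [← h0]
    positivity
  · exact le_of_mul_le_mul_right h h0

/-- A best approximant in a convex set satisfies the variational inequality. -/
theorem inner_sub_le_zero_of_forall_norm_le {C : Set V} (hC : Convex ℝ C) {x z : V} (hz : z ∈ C)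
    (hmin : ∀ w ∈ C, ‖x - z‖ ≤ ‖x - w‖) {y : V} (hy : y ∈ C) : ⟪x - z, y - z⟫ ≤ 0 := by
  refine (norm_eq_iInf_iff_real_inner_le_zero hC hz).1 ?_ y hy
  have : Nonempty C := ⟨⟨z, hz⟩⟩
  refine le_antisymm (le_ciInf fun w => hmin w w.2) ?_
  exact ciInf_le (f := fun w : C => ‖x - w‖) ⟨0, by rintro _ ⟨w, rfl⟩; exact norm_nonneg _⟩ ⟨z, hz⟩

end InnerProductSpace

/-- Two interlaced sequences whose consecutive distances contract by the factor `r`, as long as they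
stay in a ball around a point `a`, converge `R`-linearly to a common limit if they start close
enough to `a`. -/
theorem exists_forall_norm_sub_le_geometric {V : Type*} [NormedAddCommGroup V] [CompleteSpace V]
    {x y : ℕ → V} {a : V} {r ε : ℝ} (hr0 : 0 < r) (hr1 : r < 1)
    (hxy : ∀ k, ‖x (k + 1) - y k‖ ≤ ‖x k - y k‖)
    (hyx : ∀ k, ‖y k - a‖ < ε → ‖x (k + 1) - a‖ < ε →
      ‖y (k + 1) - x (k + 1)‖ ≤ r * ‖y k - x (k + 1)‖)
    (h0 : ‖x 0 - y 0‖ ≤ ‖x 0 - a‖) (ha : ‖x 0 - a‖ < ε * (1 - r) / 4) :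
    ∃ L : V, ∃ K : ℝ, ∀ k, ‖x k - L‖ ≤ K * r ^ k ∧ ‖y k - L‖ ≤ K * r ^ k := by
  have hr : 0 < 1 - r := sub_pos.2 hr1
  -- With this scaling the steps of `x` sum to at most `2 * q`, and all points stay within `3 * q <
  -- ε` of `a`.
  obtain ⟨q, hq⟩ : ∃ q, ‖x 0 - a‖ = q * (1 - r) := ⟨‖x 0 - a‖ / (1 - r), by field_simp⟩
  have hq0 : 0 ≤ q := nonneg_of_mul_nonneg_left (hq ▸ norm_nonneg _) hr
  have hqε : 4 * q < ε := by
    rw [hq, mul_div_right_comm] at ha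
    linarith [lt_of_mul_lt_mul_right ha hr.le]
  -- The two bounds need each other: staying near `a` licenses the contraction, and the decaying
  -- gaps keep the sequence near `a`. The term `2 * q * (1 - r ^ k)` is the sum of `2 * q * (1 - r)
  -- * r ^ j` over `j < k`.
  have main : ∀ k, ‖x k - y k‖ ≤ q * (1 - r) * r ^ k ∧
      ‖x k - a‖ ≤ q * (1 - r) + 2 * q * (1 - r ^ k) := by
    intro k
    induction k with
    | zero => exact ⟨by simpa [← hq] using h0, by simp [hq]⟩
    | succ k ih =>
      obtain ⟨h1, h2⟩ := ih
      have hrk : 0 < r ^ k := pow_pos hr0 k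
      have hrk1 : r ^ k ≤ 1 := pow_le_one₀ hr0.le hr1.le
      have hx := (hxy k).trans h1
      have tri : ‖y k - a‖ ≤ ‖x k - y k‖ + ‖x k - a‖ := by
        rw [norm_sub_rev (x k) (y k)]
        exact norm_sub_le_norm_sub_add_norm_sub _ _ _
      have tri' : ‖x (k + 1) - a‖ ≤ ‖x (k + 1) - y k‖ + ‖y k - a‖ :=
        norm_sub_le_norm_sub_add_norm_sub _ _ _
      have hx' : ‖x (k + 1) - a‖ ≤ q * (1 - r) + 2 * q * (1 - r ^ (k + 1)) := by
        rw [pow_succ]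
        linarith
      have hqr : 0 ≤ q * r := by positivity
      have hqk : 0 ≤ q * r ^ (k + 1) := by positivity
      have hqk' : q * (1 - r) * r ^ k ≤ q * (1 - r) :=
        mul_le_of_le_one_right (by positivity) hrk1
      have hqk'' : 0 ≤ q * r ^ k := by positivity
      refine ⟨?_, hx'⟩
      rw [norm_sub_rev]
      refine (hyx k (by linarith) (by linarith)).trans ?_
      rw [norm_sub_rev, pow_succ]
      nlinarith
  have hd : ∀ k, dist (x k) (x (k + 1)) ≤ 2 * q * (1 - r) * r ^ k := by
    intro k
    have := norm_sub_le_norm_sub_add_norm_sub (x k) (y k) (x (k + 1))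
    rw [norm_sub_rev (y k)] at this
    rw [dist_eq_norm]
    linarith [hxy k, (main k).1]
  obtain ⟨L, hL⟩ := cauchySeq_tendsto_of_complete (cauchySeq_of_le_geometric r _ hr1 hd)
  have hxL : ∀ k, ‖x k - L‖ ≤ 2 * q * r ^ k := by
    intro k
    have := dist_le_of_le_geometric_of_tendsto r _ hr1 hd hL k
    rw [dist_eq_norm] at this
    refine this.trans_eq ?_
    field_simp
  -- The tail of the steps contributes `2 * q`, the gap between `x k` and `y k` at most `q`.
  refine ⟨L, 3 * q, fun k => ?_⟩
  have hrk : 0 ≤ q * r ^ k := by positivity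
  have hrk' : 0 ≤ q * r ^ k * r := by positivity
  have tri := norm_sub_le_norm_sub_add_norm_sub (y k) (x k) L
  rw [norm_sub_rev (y k) (x k)] at tri
  constructor <;> linarith [hxL k, (main k).1]

/-- The identification of square matrices with Euclidean vectors that carries the Frobenius inner
product to the Euclidean one. -/
noncomputable def frobEquiv (N : ℕ) :
    Matrix (Fin N) (Fin N) ℝ ≃L[ℝ] EuclideanSpace ℝ (Fin N × Fin N) :=
  (((Matrix.ofLinearEquiv ℝ).symm.trans (LinearEquiv.curry ℝ ℝ (Fin N) (Fin N)).symm).trans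
    (WithLp.linearEquiv 2 ℝ (Fin N × Fin N → ℝ)).symm).toContinuousLinearEquiv

theorem inner_frobEquiv {N : ℕ} (A B : Matrix (Fin N) (Fin N) ℝ) :
    ⟪frobEquiv N A, frobEquiv N B⟫ = frobInner A B := by
  have e : ∀ (A : Matrix (Fin N) (Fin N) ℝ) p, frobEquiv N A p = A p.1 p.2 := fun _ _ => rfl
  simp only [frobInner_eq_sum, PiLp.inner_apply, e, Fintype.sum_prod_type]
  rw [Finset.sum_comm]
  simp [mul_comm]

theorem norm_frobEquiv {N : ℕ} (A : Matrix (Fin N) (Fin N) ℝ) :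
    ‖frobEquiv N A‖ = frobNorm A := by
  rw [frobNorm, ← inner_frobEquiv, norm_eq_sqrt_real_inner]

/-- The orthogonal group is closed with entries in `[-1, 1]`, hence compact, and so is its image
under conjugation of the diagonal matrix. -/
theorem isClosed_isospectralSet {N : ℕ} (lam : Fin N → ℝ) : IsClosed (isospectralSet lam) := by
  have hcpt : IsCompact (Matrix.orthogonalGroup (Fin N) ℝ : Set (Matrix (Fin N) (Fin N) ℝ)) := by
    have hK : IsCompact (Set.univ.pi fun _ => Set.univ.pi fun _ => Set.Icc (-1) 1 :
        Set (Fin N → Fin N → ℝ)) :=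
      isCompact_univ_pi fun _ => isCompact_univ_pi fun _ => isCompact_Icc
    refine IsCompact.of_isClosed_subset hK ?_ ?_
    · have : (Matrix.orthogonalGroup (Fin N) ℝ : Set (Matrix (Fin N) (Fin N) ℝ)) =
          {A | A * A.transpose = 1} := by
        ext A
        exact Matrix.mem_orthogonalGroup_iff (Fin N) ℝ
      rw [this]
      exact isClosed_eq (by fun_prop) continuous_const
    · intro A hA i _ j _
      exact abs_le.1 (entry_norm_bound_of_unitary hA i j)
  have : isospectralSet lam = (symmMatrices N : Set (Matrix (Fin N) (Fin N) ℝ)) ∩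
      (fun V => V * Matrix.diagonal lam * V.transpose) ''
        (Matrix.orthogonalGroup (Fin N) ℝ : Set (Matrix (Fin N) (Fin N) ℝ)) := by
    ext M
    simp only [isospectralSet, Set.mem_ofPred_eq, Set.mem_inter_iff, Set.mem_image, SetLike.mem_coe,
      eq_comm]
  rw [this]
  refine (Submodule.closed_of_finiteDimensional _).inter (hcpt.image ?_).isClosed
  fun_prop

theorem tendsto_iff_frobNorm_sub {N : ℕ} {ι : Type*} {l : Filter ι}
    {w : ι → Matrix (Fin N) (Fin N) ℝ} {X : Matrix (Fin N) (Fin N) ℝ} :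
    Tendsto w l (𝓝 X) ↔ Tendsto (fun i => frobNorm (w i - X)) l (𝓝 0) := by
  rw [(frobEquiv N).toHomeomorph.isInducing.tendsto_nhds_iff, tendsto_iff_norm_sub_tendsto_zero]
  simp only [← norm_frobEquiv, map_sub]
  rfl

theorem frobInner_smul_smul {N : ℕ} (a b : ℝ) (A B : Matrix (Fin N) (Fin N) ℝ) :
    frobInner (a • A) (b • B) = a * b * frobInner A B := by
  simp only [← inner_frobEquiv, map_smul, real_inner_smul_left, real_inner_smul_right]
  ring

theorem frobNorm_inv_smul_self_le_one {N : ℕ} (A : Matrix (Fin N) (Fin N) ℝ) :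
    frobNorm ((frobNorm A)⁻¹ • A) ≤ 1 := by
  rw [← norm_frobEquiv, ← norm_frobEquiv, map_smul, norm_smul, norm_inv, norm_norm]
  exact inv_mul_le_one

/-- Pairs of matrices in the Frobenius unit ball have convergent subsequences. -/
theorem exists_tendsto_subseq_of_frobNorm_le_one {N : ℕ} {u v : ℕ → Matrix (Fin N) (Fin N) ℝ}
    (hu : ∀ n, frobNorm (u n) ≤ 1) (hv : ∀ n, frobNorm (v n) ≤ 1) :
    ∃ U V : Matrix (Fin N) (Fin N) ℝ, frobNorm U ≤ 1 ∧ frobNorm V ≤ 1 ∧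
      ∃ φ : ℕ → ℕ, StrictMono φ ∧ Tendsto (u ∘ φ) atTop (𝓝 U) ∧ Tendsto (v ∘ φ) atTop (𝓝 V) := by
  have hB : IsCompact (frobEquiv N ⁻¹' Metric.closedBall 0 1) :=
    (frobEquiv N).toHomeomorph.isCompact_preimage.2 (isCompact_closedBall 0 1)
  have mem : ∀ A, A ∈ frobEquiv N ⁻¹' Metric.closedBall 0 1 ↔ frobNorm A ≤ 1 := by
    simp [norm_frobEquiv]
  have : FirstCountableTopology (Matrix (Fin N) (Fin N) ℝ) :=
    inferInstanceAs (FirstCountableTopology (Fin N → Fin N → ℝ))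
  obtain ⟨⟨U, V⟩, ⟨hU, hV⟩, φ, hφ, h⟩ := (hB.prod hB).tendsto_subseq
    (x := fun n => (u n, v n)) fun n => ⟨(mem _).2 (hu n), (mem _).2 (hv n)⟩
  exact ⟨U, V, (mem _).1 hU, (mem _).1 hV, φ, hφ, (continuous_fst.tendsto _).comp h,
    (continuous_snd.tendsto _).comp h⟩

/-- Near a point of strongly regular intersection, the angle of two successive displacements of
the alternating projections has cosine at most `r`, for any `r` above the regularity constant. -/
theorem exists_forall_frobInner_le_of_regularityConst_lt {N : ℕ}
    {E : Submodule ℝ (Matrix (Fin N) (Fin N) ℝ)} {M S : Set (Matrix (Fin N) (Fin N) ℝ)}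
    (hME : M ⊆ (E : Set (Matrix (Fin N) (Fin N) ℝ)))
    (hSE : S ⊆ (E : Set (Matrix (Fin N) (Fin N) ℝ))) {X : Matrix (Fin N) (Fin N) ℝ} {r : ℝ}
    (hr : regularityConst E M S X < r) :
    ∃ ε : ℝ, 0 < ε ∧ ∀ y ∈ S, ∀ x ∈ projSet M y, ∀ z ∈ projSet S x,
      frobNorm (y - X) < ε → frobNorm (x - X) < ε →
      frobInner (y - x) (z - x) ≤ r * frobNorm (y - x) * frobNorm (z - x) := by
  by_contra! H
  choose y hyS x hx z hz hyX hxX hlt using fun n : ℕ => H (1 / (n + 1)) Nat.one_div_pos_of_nat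
  have hε : Tendsto (fun n : ℕ => 1 / ((n : ℝ) + 1)) atTop (𝓝 0) :=
    tendsto_one_div_add_atTop_nhds_zero_nat
  have hy : Tendsto y atTop (𝓝 X) := tendsto_iff_frobNorm_sub.2 <|
    squeeze_zero (fun _ => Real.sqrt_nonneg _) (fun n => (hyX n).le) hε
  have hx' : Tendsto x atTop (𝓝 X) := tendsto_iff_frobNorm_sub.2 <|
    squeeze_zero (fun _ => Real.sqrt_nonneg _) (fun n => (hxX n).le) hε
  obtain ⟨U, V, hU, hV, φ, hφ, hUlim, hVlim⟩ := exists_tendsto_subseq_of_frobNorm_le_one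
    (fun n => frobNorm_inv_smul_self_le_one (y n - x n))
    (fun n => frobNorm_inv_smul_self_le_one (z n - x n))
  have hval : frobInner U V ∈ regularityValues E M S X := by
    refine ⟨U, V, ⟨fun n => (frobNorm (y (φ n) - x (φ n)))⁻¹, y ∘ φ, x ∘ φ,
      fun n => inv_nonneg.2 (Real.sqrt_nonneg _), fun n => hSE (hyS _), fun n => hx _,
      hy.comp hφ.tendsto_atTop, hUlim⟩, hU, ⟨fun n => (frobNorm (z (φ n) - x (φ n)))⁻¹, x ∘ φ, z ∘ φ,
      fun n => inv_nonneg.2 (Real.sqrt_nonneg _), fun n => hME (hx _).1, fun n => hz _,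
      hx'.comp hφ.tendsto_atTop, ?_⟩, hV, rfl⟩
    -- `V` is a limit of directions `z - x`, whereas the normals to `S` point along `x - z`; this is
    -- the sign in the regularity constant.
    refine hVlim.neg.congr fun n => ?_
    simp only [Function.comp_apply, ← smul_neg, neg_sub]
  have hle : r ≤ frobInner U V := by
    have hcont : Continuous fun p : Matrix (Fin N) (Fin N) ℝ × Matrix (Fin N) (Fin N) ℝ =>
        frobInner p.1 p.2 := by
      unfold frobInner
      fun_prop
    refine ge_of_tendsto ((hcont.tendsto (U, V)).comp (hUlim.prodMk_nhds hVlim))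
      (Eventually.of_forall fun n => ?_)
    have h := hlt (φ n)
    simp only [Function.comp_apply, frobInner_smul_smul]
    generalize y (φ n) - x (φ n) = A at *
    generalize z (φ n) - x (φ n) = B at *
    have hCS : frobInner A B ≤ frobNorm A * frobNorm B := by
      simpa only [← inner_frobEquiv, ← norm_frobEquiv] using real_inner_le_norm _ _
    -- A zero displacement would make both sides of the strict inequality `h` vanish.
    have hA : 0 < frobNorm A := by
      refine (Real.sqrt_nonneg _).lt_of_ne' fun (h0 : frobNorm A = 0) => ?_
      simp only [h0, mul_zero, zero_mul] at h hCS
      linarith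
    have hB : 0 < frobNorm B := by
      refine (Real.sqrt_nonneg _).lt_of_ne' fun (h0 : frobNorm B = 0) => ?_
      simp only [h0, mul_zero] at h hCS
      linarith
    rw [← mul_inv, inv_mul_eq_div, le_div_iff₀ (by positivity), ← mul_assoc]
    exact h.le
  exact absurd (le_csSup (regularityValues_bddAbove E M S X) hval) (not_le.2 (hr.trans_le hle))

/-- If `u` is dominated by `K rᵏ` in Frobenius distance to `L`, with `0 ≤ r < 1`, it tends to `L`. -/
theorem tendsto_of_frobNorm_sub_le_geometric {N : ℕ} {u : ℕ → Matrix (Fin N) (Fin N) ℝ}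
    {L : Matrix (Fin N) (Fin N) ℝ} {K r : ℝ} (hr0 : 0 ≤ r) (hr1 : r < 1)
    (h : ∀ k, frobNorm (u k - L) ≤ K * r ^ k) : Tendsto u atTop (𝓝 L) := by
  refine tendsto_iff_frobNorm_sub.2 (squeeze_zero (fun _ => Real.sqrt_nonneg _) h ?_)
  simpa using (tendsto_pow_atTop_nhds_zero_of_lt_one hr0 hr1).const_mul K

theorem theorem3 (N : ℕ) (lam : Fin N → ℝ) (hlam : Antitone lam)
    (E : Submodule ℝ (Matrix (Fin N) (Fin N) ℝ)) (hE : symmMatrices N ≤ E)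
    (S : Set (Matrix (Fin N) (Fin N) ℝ)) (hSE : S ⊆ (E : Set (Matrix (Fin N) (Fin N) ℝ)))
    (hconv : Convex ℝ S) (hclosed : IsClosed S)
    (hproj : ∀ X : Matrix (Fin N) (Fin N) ℝ, ∃! Y : Matrix (Fin N) (Fin N) ℝ, Y ∈ projSet S X)
    (Sbar : Matrix (Fin N) (Fin N) ℝ) (hSbar : Sbar ∈ isospectralSet lam ∩ S)
    (hreg : regularityConst E (isospectralSet lam) S Sbar < 1) :
    ∀ r : ℝ, regularityConst E (isospectralSet lam) S Sbar < r → r < 1 →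
      ∃ δ : ℝ, 0 < δ ∧
        ∀ x y : ℕ → Matrix (Fin N) (Fin N) ℝ,
          IsAlternatingProjection (isospectralSet lam) S x y →
          frobNorm (x 0 - Sbar) < δ →
          ∃ L ∈ isospectralSet lam ∩ S,
            Tendsto x atTop (𝓝 L) ∧ Tendsto y atTop (𝓝 L) ∧
            ∃ K : ℝ, ∀ k : ℕ,
              frobNorm (x k - L) ≤ K * r ^ k ∧ frobNorm (y k - L) ≤ K * r ^ k := by
  intro r hr hr1
  have hME : isospectralSet lam ⊆ (E : Set (Matrix (Fin N) (Fin N) ℝ)) := fun A hA => hE hA.1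
  -- Zero vectors are normals, so `0` is a regularity value and `c̄ ≥ 0`.
  have hr0 : 0 < r := by
    refine lt_of_le_of_lt (le_csSup (regularityValues_bddAbove E _ S Sbar) ?_) hr
    refine ⟨0, 0, zero_mem_normalCone (hSE hSbar.2) hSbar.1, ?_, ?_, ?_, ?_⟩
    · simp [frobNorm, frobInner]
    · simpa using zero_mem_normalCone (hSE hSbar.2) hSbar.2
    · simp [frobNorm, frobInner]
    · simp [frobInner]
  obtain ⟨ε, hε, hangle⟩ := exists_forall_frobInner_le_of_regularityConst_lt hME hSE hr
  refine ⟨ε * (1 - r) / 4, by have := sub_pos.2 hr1; positivity, fun x y hxy hx0 => ?_⟩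
  obtain ⟨hxM, hstep⟩ := hxy
  have hxM : ∀ k, x k ∈ isospectralSet lam := by
    rintro (_ | k)
    · exact hxM
    · exact (hstep k).2.1
  obtain ⟨L, K, hLK⟩ := exists_forall_norm_sub_le_geometric (x := fun k => frobEquiv N (x k))
    (y := fun k => frobEquiv N (y k)) (a := frobEquiv N Sbar) hr0 hr1
    -- `x k` itself competes in the projection of `y k` onto the isospectral set; for `k = 0` this
    -- needs `x 0` to lie there.
    (fun k => by
      rw [norm_sub_rev, norm_sub_rev (frobEquiv N (x k))]
      simpa only [← map_sub, norm_frobEquiv] using (hstep k).2.2 _ (hxM k))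
    (fun k hy hx => by
      refine norm_sub_le_mul_of_inner_le ?_ ?_ hr0.le
      · refine inner_sub_le_zero_of_forall_norm_le
          (hconv.linear_image (frobEquiv N : _ →ₗ[ℝ] EuclideanSpace ℝ (Fin N × Fin N)))
          ⟨_, (hstep (k + 1)).1.1, rfl⟩ ?_ ⟨_, (hstep k).1.1, rfl⟩
        rintro _ ⟨w, hw, rfl⟩
        have := (hstep (k + 1)).1.2 w hw
        rwa [← norm_frobEquiv, ← norm_frobEquiv, map_sub, map_sub] at this
      · simp only [← map_sub, norm_frobEquiv, inner_frobEquiv] at hx hy ⊢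
        exact hangle _ (hstep k).1.1 _ (hstep k).2 _ (hstep (k + 1)).1 hy hx)
    (by simpa only [← map_sub, norm_frobEquiv] using (hstep 0).1.2 _ hSbar.2)
    (by simpa only [← map_sub, norm_frobEquiv] using hx0)
  obtain ⟨L, rfl⟩ := (frobEquiv N).surjective L
  simp only [← map_sub, norm_frobEquiv] at hLK
  have hxL := tendsto_of_frobNorm_sub_le_geometric hr0.le hr1 fun k => (hLK k).1
  have hyL := tendsto_of_frobNorm_sub_le_geometric hr0.le hr1 fun k => (hLK k).2
  exact ⟨L, ⟨(isClosed_isospectralSet lam).mem_of_tendsto hxL (Eventually.of_forall hxM),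
    hclosed.mem_of_tendsto hyL (Eventually.of_forall fun k => (hstep k).1.1)⟩, hxL, hyL, K, hLK⟩
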